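/- Let $n\ge 2$ and let $H^n$ be the $n$-dimensional hyperbolic space with geodesic distance $d$. A convex body in $H^n$ is a compact, geodesically convex set with non-empty interior. A set $L\subseteq H^n$ is called complete if $\operatorname{diam}(L\cup\{y\})>\operatorname{diam}(L)$ for every $y\in H^n\setminus L$, and a completion of $K$ is a complete set $L\supseteq K$ with $\operatorname{diam}(L)=\operatorname{diam}(K)$. The circumscribed ball of a bounded set is the closed ball $\{x\in H^n : d(x,z)\le R\}$ of minimal radius $R\geq 0$ containing it. Theorem. Let $K\subset H^n$ be a convex body of diameter $D$ with circumscribed ball $B$. Then there exists a completion $\widetilde K$ of $K$ such that $B$ is also the circumscribed ball of $\widetilde K$. -/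

import Mathlib

/-- The ambient space `ℝⁿ⁺¹ = e^⊥ ⊕ ℝ e`; the pair `(x₀, t)` stands for `x₀ + t e`. -/
abbrev Ambient (n : ℕ) : Type := EuclideanSpace ℝ (Fin n) × ℝ

/-- The symmetric bilinear form `𝓑(x₀ + t e, y₀ + s e) = t s - ⟨x₀, y₀⟩` on `ℝⁿ⁺¹`. -/
noncomputable def lorentz {n : ℕ} (x y : Ambient n) : ℝ :=
  x.2 * y.2 - inner ℝ x.1 y.1

/-- The `n`-dimensional hyperbolic space (hyperboloid model): the points `x₀ + t e` of `ℝⁿ⁺¹`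
with `t ≥ 1` and `t² - ⟨x₀, x₀⟩ = 1`. -/
@[ext]
structure HyperbolicSpace (n : ℕ) where
  val : Ambient n
  one_le_time : 1 ≤ val.2
  lorentz_self : lorentz val val = 1

namespace HyperbolicSpace

variable {n : ℕ}

theorem lorentz_comm (x y : Ambient n) : lorentz x y = lorentz y x := by
  unfold lorentz
  rw [real_inner_comm, mul_comm]

theorem lorentz_add_left (x y z : Ambient n) :
    lorentz (x + y) z = lorentz x z + lorentz y z := by
  unfold lorentz
  simp only [Prod.fst_add, Prod.snd_add, inner_add_left]
  ring

theorem lorentz_smul_left (c : ℝ) (x z : Ambient n) :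
    lorentz (c • x) z = c * lorentz x z := by
  unfold lorentz
  simp only [Prod.smul_fst, Prod.smul_snd, real_inner_smul_left, smul_eq_mul]
  ring

theorem lorentz_add_right (x y z : Ambient n) :
    lorentz x (y + z) = lorentz x y + lorentz x z := by
  rw [lorentz_comm, lorentz_add_left, lorentz_comm y, lorentz_comm z]

theorem lorentz_smul_right (c : ℝ) (x z : Ambient n) :
    lorentz x (c • z) = c * lorentz x z := by
  rw [lorentz_comm, lorentz_smul_left, lorentz_comm]

/-- The form `-𝓑` is positive definite on the tangent space `T_y = {w | 𝓑(w, y) = 0}`. -/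
theorem norm_sq_le_of_tangent (y : HyperbolicSpace n) (w : Ambient n)
    (hw : lorentz w y.val = 0) : ‖w.1‖ ^ 2 ≤ y.val.2 ^ 2 * (-lorentz w w) := by
  have hy := y.lorentz_self
  unfold lorentz at *
  have hc := real_inner_mul_inner_self_le w.1 y.val.1
  rw [← real_inner_self_eq_norm_sq]
  have h1 : inner ℝ w.1 y.val.1 = w.2 * y.val.2 := by linarith
  rw [h1] at hc
  have h2 : inner ℝ y.val.1 y.val.1 = y.val.2 * y.val.2 - 1 := by linarith
  rw [h2] at hc
  nlinarith

theorem neg_lorentz_nonneg (y : HyperbolicSpace n) (w : Ambient n)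
    (hw : lorentz w y.val = 0) : 0 ≤ -lorentz w w := by
  have h := norm_sq_le_of_tangent y w hw
  have h1 := y.one_le_time
  have h2 : 0 < y.val.2 ^ 2 := by positivity
  exact nonneg_of_mul_nonneg_right ((sq_nonneg _).trans h) h2

theorem eq_zero_of_tangent (y : HyperbolicSpace n) (w : Ambient n)
    (hw : lorentz w y.val = 0) (h0 : lorentz w w = 0) : w = 0 := by
  have h := norm_sq_le_of_tangent y w hw
  rw [h0] at h
  have h1 : w.1 = 0 := by
    have : ‖w.1‖ ^ 2 = 0 := le_antisymm (by simpa using h) (sq_nonneg _)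
    simpa using this
  have h2 : w.2 = 0 := by
    unfold lorentz at h0
    rw [h1] at h0
    simpa using h0
  exact Prod.ext h1 h2

theorem one_le_lorentz (x y : HyperbolicSpace n) : 1 ≤ lorentz x.val y.val := by
  have hx := x.lorentz_self
  have hy := y.lorentz_self
  have hx1 := x.one_le_time
  have hy1 := y.one_le_time
  unfold lorentz at *
  have hc := real_inner_le_norm x.val.1 y.val.1
  rw [real_inner_self_eq_norm_sq] at hx hy
  have ha := norm_nonneg x.val.1
  have hb := norm_nonneg y.val.1
  have h : 1 + ‖x.val.1‖ * ‖y.val.1‖ ≤ x.val.2 * y.val.2 := by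
    refine abs_le_of_sq_le_sq' ?_ (by positivity) |>.2
    nlinarith [sq_nonneg (‖x.val.1‖ - ‖y.val.1‖)]
  linarith

theorem lorentz_cauchy_schwarz (x y z : HyperbolicSpace n) :
    (lorentz x.val y.val * lorentz y.val z.val - lorentz x.val z.val) ^ 2 ≤
      (lorentz x.val y.val ^ 2 - 1) * (lorentz y.val z.val ^ 2 - 1) := by
  set a := lorentz x.val y.val with ha
  set b := lorentz y.val z.val with hb
  set c := lorentz x.val z.val with hc
  have key : ∀ s : ℝ, 0 ≤ (b ^ 2 - 1) * (s * s) + (2 * (a * b - c)) * s + (a ^ 2 - 1) := by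
    intro s
    have h := neg_lorentz_nonneg y
      ((x.val + (-a) • y.val) + s • (z.val + (-b) • y.val)) (by
        simp only [lorentz_add_left, lorentz_smul_left, y.lorentz_self,
          lorentz_comm z.val y.val, ← ha, ← hb]
        ring)
    simp only [lorentz_add_left, lorentz_smul_left, lorentz_add_right, lorentz_smul_right,
      y.lorentz_self, x.lorentz_self, z.lorentz_self, lorentz_comm z.val y.val,
      lorentz_comm y.val x.val, lorentz_comm z.val x.val, ← ha, ← hb, ← hc] at h
    nlinarith
  have := discrim_le_zero key
  unfold discrim at this
  nlinarith

/-- The geodesic distance, `cosh d(x, y) = 𝓑(x, y)`. -/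
noncomputable instance : Dist (HyperbolicSpace n) :=
  ⟨fun x y => Real.arcosh (lorentz x.val y.val)⟩

theorem dist_def (x y : HyperbolicSpace n) : dist x y = Real.arcosh (lorentz x.val y.val) := rfl

theorem cosh_dist (x y : HyperbolicSpace n) : Real.cosh (dist x y) = lorentz x.val y.val :=
  Real.cosh_arcosh (one_le_lorentz x y)

theorem dist_nonneg' (x y : HyperbolicSpace n) : 0 ≤ dist x y :=
  Real.arcosh_nonneg (one_le_lorentz x y)

theorem dist_triangle' (x y z : HyperbolicSpace n) : dist x z ≤ dist x y + dist y z := by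
  have h1 := dist_nonneg' x y
  have h2 := dist_nonneg' y z
  rw [← abs_of_nonneg (dist_nonneg' x z), ← abs_of_nonneg (add_nonneg h1 h2),
    ← Real.cosh_le_cosh, Real.cosh_add]
  have hc := lorentz_cauchy_schwarz x y z
  rw [← cosh_dist x y, ← cosh_dist y z, ← cosh_dist x z, ← Real.sinh_sq, ← Real.sinh_sq,
    ← mul_pow] at hc
  have h3 := abs_le_of_sq_le_sq' hc
    (mul_nonneg (Real.sinh_nonneg_iff.2 h1) (Real.sinh_nonneg_iff.2 h2))
  linarith [h3.1]

noncomputable instance : MetricSpace (HyperbolicSpace n) where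
  dist_self x := by rw [dist_def, x.lorentz_self, ← Real.cosh_zero, Real.arcosh_cosh le_rfl]
  dist_comm x y := by rw [dist_def, dist_def, lorentz_comm]
  dist_triangle := dist_triangle'
  eq_of_dist_eq_zero := by
    intro x y h
    have hc := cosh_dist x y
    rw [h, Real.cosh_zero] at hc
    have := eq_zero_of_tangent y (x.val + (-1 : ℝ) • y.val)
      (by simp only [lorentz_add_left, lorentz_smul_left, ← hc, y.lorentz_self]; ring)
      (by
        simp only [lorentz_add_left, lorentz_smul_left, lorentz_add_right, lorentz_smul_right,
          lorentz_comm y.val x.val, ← hc, y.lorentz_self, x.lorentz_self]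
        ring)
    apply HyperbolicSpace.ext
    rwa [neg_one_smul, ← sub_eq_add_neg, sub_eq_zero] at this

/-- The geodesic segment `[x, y]`: if `y = x cosh t + u sinh t` with `t ≥ 0` and `u ∈ T_x` a unit
tangent vector, it consists of the points `x cosh s + u sinh s` with `0 ≤ s ≤ t`. -/
def geodesicSegment (x y : HyperbolicSpace n) : Set (HyperbolicSpace n) :=
  {w | ∃ (u : Ambient n) (s t : ℝ), lorentz u x.val = 0 ∧ -lorentz u u = 1 ∧ 0 ≤ s ∧ s ≤ t ∧
    y.val = Real.cosh t • x.val + Real.sinh t • u ∧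
    w.val = Real.cosh s • x.val + Real.sinh s • u}

/-- `K` is convex if it contains the geodesic segment between any two of its points. -/
def IsGeodesicallyConvex (K : Set (HyperbolicSpace n)) : Prop :=
  ∀ x ∈ K, ∀ y ∈ K, geodesicSegment x y ⊆ K

/-- A convex body: a compact convex set with non-empty interior. -/
def IsConvexBody (K : Set (HyperbolicSpace n)) : Prop :=
  IsCompact K ∧ IsGeodesicallyConvex K ∧ (interior K).Nonempty

/-- `K` is (diametrically) complete if adding any point outside `K` strictly increases the
diameter. The diameter is taken in `[0, ∞]`. -/
def IsDiamComplete (K : Set (HyperbolicSpace n)) : Prop :=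
  ∀ y, y ∉ K → Metric.ediam K < Metric.ediam (K ∪ {y})

/-- `L` is a completion of `K`: a complete set containing `K` and of the same diameter. -/
def IsCompletion (L K : Set (HyperbolicSpace n)) : Prop :=
  IsDiamComplete L ∧ K ⊆ L ∧ Metric.ediam L = Metric.ediam K

/-- `R` is the circumradius of `K`: the minimal radius of a ball containing `K`. -/
def IsCircumradius (R : ℝ) (K : Set (HyperbolicSpace n)) : Prop :=
  IsLeast {r : ℝ | 0 ≤ r ∧ ∃ z : HyperbolicSpace n, K ⊆ Metric.closedBall z r} R

/-- `B` is a circumscribed ball of `K`: a ball that contains `K` and whose radius is the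
circumradius of `K`. -/
def IsCircumscribedBall (B K : Set (HyperbolicSpace n)) : Prop :=
  ∃ (p : HyperbolicSpace n) (R : ℝ),
    IsCircumradius R K ∧ B = Metric.closedBall p R ∧ K ⊆ B

end HyperbolicSpace

namespace HyperbolicSpace

/-! Let `B` have centre `p` and radius `R`. Zorn's lemma (`exists_maximal_dist_le`) gives a maximal
`M` among the sets of diameter at most `D` between `K` and `B`; maximality only tests points of `B`,
so completeness needs an argument for points outside. By the triangle inequality, the ball of radius
`D - R` about `p` is within `D` of all of `B`, hence lies in `M`. If `y` is within `D` of all of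
`M`, prolonging the geodesic from `y` through `p` by `D - R` ends in that ball, so `dist y p + (D -
R) ≤ D`. Thus `y ∈ B`, and maximality puts `y` in `M`. -/

theorem time_sq_lt_of_unit_tangent {n : ℕ} (p : HyperbolicSpace n) (u : Ambient n)
    (hup : lorentz u p.val = 0) (huu : lorentz u u = -1) : u.2 ^ 2 < p.val.2 ^ 2 := by
  have h := norm_sq_le_of_tangent p u hup
  rw [huu] at h
  unfold lorentz at huu
  rw [real_inner_self_eq_norm_sq] at huu
  nlinarith

/-- The point reached from `p` after time `r` along the geodesic with unit velocity `u`. -/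
theorem exists_point_of_unit_tangent {n : ℕ} (p : HyperbolicSpace n) (u : Ambient n)
    (hup : lorentz u p.val = 0) (huu : lorentz u u = -1) (r : ℝ) :
    ∃ q : HyperbolicSpace n, q.val = Real.cosh r • p.val + Real.sinh r • u := by
  have hself : lorentz (Real.cosh r • p.val + Real.sinh r • u)
      (Real.cosh r • p.val + Real.sinh r • u) = 1 := by
    simp only [lorentz_add_left, lorentz_smul_left, lorentz_add_right, lorentz_smul_right,
      p.lorentz_self, lorentz_comm p.val u, hup, huu]
    linarith [Real.cosh_sq r]
  refine ⟨⟨_, ?_, hself⟩, rfl⟩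
  set w := Real.cosh r • p.val + Real.sinh r • u with hw
  have hp := p.one_le_time
  have hw2 : w.2 = Real.cosh r * p.val.2 + Real.sinh r * u.2 := by simp [hw]
  -- The `cosh` term dominates for either sign of `r`, which keeps the point on the upper sheet.
  have hsq : (Real.sinh r * u.2) ^ 2 < (Real.cosh r * p.val.2) ^ 2 := by
    have h := time_sq_lt_of_unit_tangent p u hup huu
    rw [mul_pow, mul_pow, Real.cosh_sq]
    nlinarith [mul_le_mul_of_nonneg_left h.le (sq_nonneg (Real.sinh r))]
  have hpos : 0 < w.2 := by
    rw [hw2]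
    have hc : 0 < Real.cosh r * p.val.2 := mul_pos (Real.cosh_pos r) (by linarith)
    linarith [(abs_lt_of_sq_lt_sq' hsq hc.le).1]
  have h1 : 1 ≤ w.2 ^ 2 := by
    unfold lorentz at hself
    rw [real_inner_self_eq_norm_sq] at hself
    nlinarith [sq_nonneg ‖w.1‖]
  nlinarith

/-- Geodesics extend: beyond `p`, seen from `y ≠ p`, there are points at every distance. -/
theorem exists_extend_geodesic {n : ℕ} {y p : HyperbolicSpace n} (hyp : y ≠ p) {r : ℝ}
    (hr : 0 ≤ r) : ∃ q : HyperbolicSpace n, dist p q = r ∧ dist y q = dist y p + r := by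
  have ha : 0 < dist y p := dist_pos.2 hyp
  have hc := cosh_dist y p
  set a := dist y p
  have hs : 0 < Real.sinh a := Real.sinh_pos_iff.2 ha
  have hcs := Real.cosh_sq a
  -- The velocity at `p` of the geodesic coming from `y`: solve `y = cosh a • p - sinh a • u` for
  -- `u`.
  set u : Ambient n := (Real.sinh a)⁻¹ • (Real.cosh a • p.val + (-1 : ℝ) • y.val) with hu
  have hup : lorentz u p.val = 0 := by
    simp only [hu, lorentz_add_left, lorentz_smul_left, p.lorentz_self, ← hc]
    ring
  have huy : lorentz u y.val = Real.sinh a := by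
    simp only [hu, lorentz_add_left, lorentz_smul_left, y.lorentz_self, lorentz_comm p.val y.val,
      ← hc]
    field_simp
    linarith
  have huu : lorentz u u = -1 := by
    have : lorentz u u = (Real.sinh a)⁻¹ * (Real.cosh a * lorentz u p.val
        + (-1) * lorentz u y.val) := by
      conv_lhs => rw [hu, lorentz_smul_left, lorentz_add_left, lorentz_smul_left,
        lorentz_smul_left, ← hu, lorentz_comm p.val u, lorentz_comm y.val u]
    rw [this, hup, huy]
    field_simp
    ring
  obtain ⟨q, hq⟩ := exists_point_of_unit_tangent p u hup huu r
  refine ⟨q, ?_, ?_⟩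
  · rw [dist_def, hq, lorentz_add_right, lorentz_smul_right, lorentz_smul_right, p.lorentz_self,
      lorentz_comm p.val u, hup, mul_zero, add_zero, mul_one, Real.arcosh_cosh hr]
  · rw [dist_def, hq, lorentz_add_right, lorentz_smul_right, lorentz_smul_right, ← hc,
      lorentz_comm y.val u, huy, mul_comm, mul_comm (Real.sinh r), ← Real.cosh_add,
      Real.arcosh_cosh (by positivity)]

/-- The point of the ball opposite to `y` is at distance exactly `dist y p + r` from `y`. For `y =
p` there is no direction to prolong, and `r ≤ D` suffices. -/
theorem dist_le_of_forall_closedBall {n : ℕ} {y p : HyperbolicSpace n} {r D : ℝ} (hr : 0 ≤ r)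
    (hrD : r ≤ D) (h : ∀ q ∈ Metric.closedBall p r, dist y q ≤ D) : dist y p ≤ D - r := by
  rcases eq_or_ne y p with rfl | hyp
  · simpa using hrD
  · obtain ⟨q, hpq, hyq⟩ := exists_extend_geodesic hyp hr
    have := h q (by rw [Metric.mem_closedBall, dist_comm, hpq])
    linarith

end HyperbolicSpace

/-- Among the sets of diameter at most `D` between `K` and `B` there is one that contains every
point of `B` at distance at most `D` from all of its points. -/
theorem exists_maximal_dist_le {X : Type*} [PseudoMetricSpace X] {K B : Set X} {D : ℝ}
    (hD : 0 ≤ D) (hKB : K ⊆ B) (hK : ∀ x ∈ K, ∀ y ∈ K, dist x y ≤ D) :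
    ∃ M, K ⊆ M ∧ M ⊆ B ∧ (∀ x ∈ M, ∀ y ∈ M, dist x y ≤ D) ∧
      ∀ y ∈ B, (∀ x ∈ M, dist y x ≤ D) → y ∈ M := by
  obtain ⟨M, hKM, hM⟩ := zorn_subset_nonempty
    {S : Set X | S ⊆ B ∧ ∀ x ∈ S, ∀ y ∈ S, dist x y ≤ D}
    (fun c hc hchain _ => by
      refine ⟨⋃₀ c, ⟨Set.sUnion_subset fun S hS => (hc hS).1, ?_⟩,
        fun S hS => Set.subset_sUnion_of_mem hS⟩
      rintro x ⟨S, hS, hx⟩ y ⟨T, hT, hy⟩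
      rcases hchain.total hS hT with h | h
      · exact (hc hT).2 x (h hx) y hy
      · exact (hc hS).2 x hx y (h hy))
    K ⟨hKB, hK⟩
  refine ⟨M, hKM, hM.prop.1, hM.prop.2, fun y hy hyM => ?_⟩
  refine hM.le_of_ge (y := insert y M) ⟨Set.insert_subset hy hM.prop.1, ?_⟩
    (Set.subset_insert y M) (Set.mem_insert y M)
  rintro a (rfl | ha) b (rfl | hb)
  · simpa using hD
  · exact hyM b hb
  · rw [dist_comm]
    exact hyM a ha
  · exact hM.prop.2 a ha b hb

theorem theorem1p3 (n : ℕ) (hn : 2 ≤ n) (K B : Set (HyperbolicSpace n)) (D : ℝ)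
    (hK : HyperbolicSpace.IsConvexBody K) (hD : Metric.diam K = D)
    (hB : HyperbolicSpace.IsCircumscribedBall B K) :
    ∃ L : Set (HyperbolicSpace n),
      HyperbolicSpace.IsCompletion L K ∧ Metric.diam L = D ∧
        HyperbolicSpace.IsCircumscribedBall B L := by
  obtain ⟨p, R, hR, rfl, hKB⟩ := hB
  have hbdd := hK.1.isBounded
  have hdist : ∀ x ∈ K, ∀ y ∈ K, dist x y ≤ D := fun x hx y hy =>
    hD ▸ Metric.dist_le_diam_of_mem hbdd hx hy
  have hD0 : 0 ≤ D := hD ▸ Metric.diam_nonneg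
  obtain ⟨k, hk⟩ := hK.2.2.mono interior_subset
  -- A ball of radius `D` about any point of `K` contains `K`.
  have hRD : R ≤ D := hR.2 ⟨hD0, k, fun x hx => hdist x hx k hk⟩
  have hD2 : D ≤ 2 * R := hD ▸ Metric.diam_le_of_subset_closedBall hR.1.1 hKB
  obtain ⟨M, hKM, hMB, hMD, hmax⟩ := exists_maximal_dist_le hD0 hKB hdist
  have hball : Metric.closedBall p (D - R) ⊆ M := fun q hq =>
    -- The small ball lies in `B` because `D - R ≤ R`.
    hmax q (Metric.closedBall_subset_closedBall (by linarith) hq) fun x hx => by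
      have h1 := Metric.mem_closedBall.1 hq
      have h2 := Metric.mem_closedBall.1 (hMB hx)
      linarith [dist_triangle_right q x p]
  have hediamK : Metric.ediam K = ENNReal.ofReal D := by
    rw [← hD, Metric.diam, ENNReal.ofReal_toReal hbdd.ediam_ne_top]
  have hediam : Metric.ediam M = Metric.ediam K := by
    refine le_antisymm (Metric.ediam_le fun x hx y hy => ?_) (Metric.ediam_mono hKM)
    rw [hediamK, edist_dist]
    exact ENNReal.ofReal_le_ofReal (hMD x hx y hy)
  refine ⟨M, ⟨fun y hyM => ?_, hKM, hediam⟩, ?_, p, R, ⟨⟨hR.1.1, p, hMB⟩, ?_⟩, rfl, hMB⟩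
  · by_contra! hle
    have hyD : ∀ x ∈ M, dist y x ≤ D := fun x hx => by
      have h := (Metric.edist_le_ediam_of_mem (s := M ∪ {y}) (Or.inr rfl) (Or.inl hx)).trans hle
      rwa [hediam, hediamK, edist_dist, ENNReal.ofReal_le_ofReal_iff hD0] at h
    have hyp := HyperbolicSpace.dist_le_of_forall_closedBall (sub_nonneg.2 hRD)
      (by linarith [hR.1.1]) fun q hq => hyD q (hball hq)
    exact hyM (hmax y (by simpa using hyp) hyD)
  · rw [Metric.diam, hediam, ← hD, Metric.diam]
  -- A ball containing `M` contains `K`, so its radius is at least `R`.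
  · rintro r ⟨hr, z, hz⟩
    exact hR.2 ⟨hr, z, hKM.trans hz⟩
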